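/- **Tilted algorithm gap size ratio upper bound.** Let $S=2^{\hat s}$ with $\hat s\ge 2$ be the buffer size. Data items are identified with their ingest times $0,1,2,\dots$; at logical time $T$ exactly the items $0,\dots,T-1$ have been ingested. Let $H(T)=\max\{n: 2^n \mid T+1\}$ be the hanoi value of $T$. The epoch of $T$ is $t=\lfloor\log_2 T\rfloor-\hat s+1$ if $T\ge S$ and $t=0$ otherwise. The meta-epoch of epoch $t$ is $\tau=0$ if $t=0$, and otherwise the largest $\tau$ with $2^\tau-\tau\le t$. *Tilted algorithm.* The sites $0,\dots,S-1$ are divided, from left to right, into segments number $0,1,\dots,S/2-1$ of sizes $\hat s+1, H(0)+1, H(1)+1,\dots,H(S/2-2)+1$. In fill order, segments are sorted by decreasing size and, among equal sizes, from left to right. Item $T$, with $h=H(T)$ and epoch $t$, is written to the site at offset $h$ from the start of the segment whose index in fill order (counted from $0$) is $\lfloor T/2^{h+1}\rfloor \bmod B$, overwriting what was there. Here $B=\max(1,\lfloor S/2^{\tau+1-\epsilon}\rfloor)$, where $\epsilon=1$ if $t< h+2^\tau-\tau<2^{\tau+1}-(\tau+1)$ and $\epsilon=0$ otherwise. Let $\mathcal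 B_T$ be the set of items present in the buffer at time $T$. *Gap size ratio.* For a set $\mathcal B$ of items and $0\le u<T$, let $G_T(u)$ be the largest $i+j$ with $i,j\in\mathbb N$ such that all integers in $[u-i,u+j)$ belong to $\{0,\dots,T-1\}\setminus\mathcal B$, and let $\mathrm{cost}(\mathcal B,T)=\max_{0\le u<T-1} G_T(u)/(T-1-u)$ (read as $0$ if there is no such $u$). Then for every $T$ with $0\le T<2^{S-1}$, with $t$ the epoch of $T$ and $\tau$ the meta-epoch of $t$: 1. for every $h\ge 0$, the most recent $2^{\hat s-1-\tau}$ items of hanoi value $h$ ingested before time $T$ (all of them, if there are fewer) belong to $\mathcal B_T$; 2. for every $n\ge 1$ and every set $\mathcal B$ that contains, for each $h\ge0$, the most recent $n$ items of hanoi value $h$ ingested before time $T$ (all of them, if there are fewer), $\mathrm{cost}(\mathcal B,T)\le \dfrac{1}{n-1/2}$; 3. if $t\ge 1$, then $$\mathrm{cost}(\mathcal B_T,T)\le\frac{1}{\max\Big(\frac{S}{2(t+\hat s)},\ \frac{S}{4t},\ \frac{S}{2^{\tau+1}}\Big)-\frac12},$$ and if $t=0$ (where $S/(4t)$ is read as $+\infty$),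 then $\mathrm{cost}(\mathcal B_T,T)=0$; 4. $\mathrm{cost}(\mathcal B_T,T)\le 2$. -/

import Mathlib

namespace Tilted

/-! Throughout, the buffer size is `S = 2 ^ s`. Data items are identified with their ingest times
`0, 1, 2, …`, and at logical time `T` exactly the items `0, …, T - 1` have been ingested. -/

/-- Hanoi value of a time: the largest `n` such that `2 ^ n` divides `T + 1`. -/
def hanoi (T : ℕ) : ℕ := padicValNat 2 (T + 1)

/-- Epoch of time `T`: `⌊log₂ T⌋ - s + 1` if `T ≥ S`, and `0` otherwise. -/
def epoch (s T : ℕ) : ℕ := if 2 ^ s ≤ T then Nat.log 2 T - s + 1 else 0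

/-- Meta-epoch of epoch `t`. Meta-epoch `0` is epoch `0`, and meta-epoch `m ≥ 1` begins at epoch
`2 ^ m - m`. (Since `m ≤ 2 ^ m - m` for `m ≥ 1`, the search bound `t` is no restriction.) -/
def metaEpoch (t : ℕ) : ℕ :=
  if t = 0 then 0 else Nat.findGreatest (fun m => 2 ^ m - m ≤ t) t

/-! ### Site selection -/

/-- Initial sizes of the reservation segments, listed from left to right in buffer space:
`s + 1, H(0) + 1, H(1) + 1, …, H(S / 2 - 2) + 1`. -/
def segSize (s : ℕ) : ℕ → ℕ
  | 0 => s + 1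
  | m + 1 => hanoi m + 1

/-- Leftmost buffer site of the `m`-th segment from the left. -/
def segStart (s m : ℕ) : ℕ := ∑ j ∈ Finset.range m, segSize s j

/-- Left-to-right index of the segment that is `b`-th in fill order. Segments are filled by
decreasing initial size and, among segments of the same size, from left to right. Here
`Nat.size b` is the bit length of `b`: it is the nesting level `v` of the segment, the segments of
level `v ≥ 1` are `w = S / 2 ^ v` apart, the first of them has index `w / 2`, and `b - 2 ^ (v - 1)`
is the position within the level. -/
def segIndex (s b : ℕ) : ℕ :=
  if b = 0 then 0
  else 2 ^ s / 2 ^ Nat.size b / 2 + 2 ^ s / 2 ^ Nat.size b * (b - 2 ^ (Nat.size b - 1))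

/-- Number of segments over which the hanoi value `h` cycles during epoch `t` (the size of its ring
buffer). In meta-epoch `m` it is `S / 2 ^ (m + 1)`, or twice that if the invasion under way
(which, one site per epoch, eliminates segments of size `2 ^ m - 1`) has yet to reach `h`. -/
def ringSize (s t h : ℕ) : ℕ :=
  let m := metaEpoch t
  let t₀ := 2 ^ m - m
  let t₁ := 2 ^ (m + 1) - (m + 1)
  let ε := if t < h + t₀ ∧ h + t₀ < t₁ then 1 else 0
  max 1 (2 ^ s / 2 ^ (m + 1 - ε))

/-- The tilted site selection: the buffer site at which the data item with ingest time `T` is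
stored. The number of earlier items with the same hanoi value `h` is `⌊T / 2 ^ (h + 1)⌋`; reduced
modulo the ring size it gives the segment used, in fill order, and `h` is the offset inside the
segment. -/
def site (s T : ℕ) : ℕ :=
  segStart s (segIndex s (T / 2 ^ (hanoi T + 1) % ringSize s (epoch s T) (hanoi T))) + hanoi T

/-! ### Buffer content and gap sizes -/

/-- Buffer content at logical time `T`. Each ingested item is written to its selected site,
overwriting what was there; nothing else ever happens to the buffer. -/
def buffer (s : ℕ) : ℕ → ℕ → Option ℕ
  | 0 => fun _ => none
  | T + 1 => Function.update (buffer s T) (site s T) (some T)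

/-- The items retained at logical time `T`: those found at one of the sites `0, …, S - 1`. -/
def retained (s T : ℕ) : Set ℕ := {u | ∃ k < 2 ^ s, buffer s T k = some u}

/-- Items ingested before time `T` that do not belong to the collection `B`. -/
def discarded (B : Set ℕ) (T : ℕ) : Set ℕ := {u | u < T ∧ u ∉ B}

/-- Gap size at the ingest time `u` at logical time `T`, when the collection `B` is retained:
the largest `i + j` such that all integers in `[u - i, u + j)` are discarded items. For discarded
`u` this is the length of the maximal run of consecutive discarded items containing `u`. (For
retained `u` it is the length of the run of discarded items that ends right before `u`, so it
dominates the convention that the gap size is `0` there.) -/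
noncomputable def gapSize (B : Set ℕ) (T u : ℕ) : ℕ :=
  sSup {g : ℕ | ∃ i j : ℕ, g = i + j ∧
    Set.Ico ((u : ℤ) - i) ((u : ℤ) + j) ⊆ ((↑) : ℕ → ℤ) '' discarded B T}

/-- The supremum in `gapSize` is a maximum. -/
theorem gapSize_isGreatest (B : Set ℕ) (T u : ℕ) :
    IsGreatest {g : ℕ | ∃ i j : ℕ, g = i + j ∧
      Set.Ico ((u : ℤ) - i) ((u : ℤ) + j) ⊆ ((↑) : ℕ → ℤ) '' discarded B T} (gapSize B T u) := by
  have hne : {g : ℕ | ∃ i j : ℕ, g = i + j ∧ Set.Ico ((u : ℤ) - i) ((u : ℤ) + j) ⊆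
      ((↑) : ℕ → ℤ) '' discarded B T}.Nonempty := ⟨0, 0, 0, rfl, by simp⟩
  have hbd : BddAbove {g : ℕ | ∃ i j : ℕ, g = i + j ∧ Set.Ico ((u : ℤ) - i) ((u : ℤ) + j) ⊆
      ((↑) : ℕ → ℤ) '' discarded B T} := by
    refine ⟨T, ?_⟩
    rintro g ⟨i, j, rfl, h⟩
    by_cases h0 : i + j = 0
    · omega
    obtain ⟨v, -, hv⟩ := h (show (u : ℤ) - i ∈ _ from ⟨le_refl _, by omega⟩)
    obtain ⟨w, ⟨hw, -⟩, hw'⟩ := h (show (u : ℤ) + j - 1 ∈ _ from ⟨by omega, by omega⟩)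
    omega
  exact ⟨Nat.sSup_mem hne hbd, fun g hg => le_csSup hbd hg⟩

/-- The tilted cost at logical time `T` when the collection `B` is retained: the maximum of
`G_T(u) / (T - 1 - u)` over the ingest times `0 ≤ u < T - 1` (a finite family; the value is `0` if
there is no such `u`). -/
noncomputable def cost (B : Set ℕ) (T : ℕ) : ℝ :=
  ⨆ u : Fin (T - 1), (gapSize B T u : ℝ) / ((T : ℝ) - 1 - (u : ℕ))

/-- The most recent `n` items of hanoi value `h` ingested before time `T` (all of them, if there
are fewer than `n`). -/
def lastInstances (n h T : ℕ) : Set ℕ :=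
  {u | u < T ∧ hanoi u = h ∧ ((Finset.Ioo u T).filter (fun v => hanoi v = h)).card < n}

end Tilted

namespace Tilted

/-! Write `u + 1 = (2q + 1) 2^h`: here `h` is the hanoi value of `u`, and `q` counts the earlier
items of that value, which lie `2^(h+1)` apart.

Cost: in a run of discarded items let `v` have the largest hanoi value `h`. The run stays within
distance `2^h` of `v` and has length at most `2^(h+1)`. If the last `n` items of value `h` are kept,
`v` precedes `T` by more than `n 2^(h+1)`, and the ratio is at most `2^(h+1) / (n 2^(h+1) - 2^h)`.

Retention: in meta-epoch `m` the segments of index divisible by `2^m` survive. Each grows by one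
site per epoch, into the neighbour at an odd multiple of `2^(m-1)`. `Valid` records the positions in
use; they occupy distinct sites (`Valid.injective`), and every item is written to one
(`valid_item`). So an item is overwritten either by its own ring, a full cycle later
(`le_of_bunch_eq`), or by an invading segment. In the second case (`le_of_site_eq`) the overwriting
item either comes from a later epoch or has a hanoi value so large that it arrives late enough. -/

/-! ### Arithmetic of hanoi values -/

theorem hanoi_spec (u : ℕ) : u + 1 = (2 * (u / 2 ^ (hanoi u + 1)) + 1) * 2 ^ hanoi u := by
  obtain ⟨k, hk⟩ : 2 ^ hanoi u ∣ u + 1 := pow_padicValNat_dvd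
  have hnd : ¬ 2 ^ (hanoi u + 1) ∣ u + 1 := pow_succ_padicValNat_not_dvd (by omega)
  have hpos : 0 < 2 ^ hanoi u := by positivity
  rcases Nat.even_or_odd' k with ⟨q, rfl | rfl⟩
  · exact absurd ⟨q, by rw [hk, pow_succ]; ring⟩ hnd
  · have : u / 2 ^ (hanoi u + 1) = q := by
      rw [mul_add, mul_one] at hk
      exact Nat.div_eq_of_lt_le (by rw [pow_succ]; nlinarith) (by rw [pow_succ]; nlinarith)
    rw [this, hk, mul_comm]

theorem hanoi_eq_of_succ_eq {u q h : ℕ} (e : u + 1 = (2 * q + 1) * 2 ^ h) : hanoi u = h := by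
  have : Fact (Nat.Prime 2) := ⟨Nat.prime_two⟩
  rw [hanoi, e, padicValNat.mul (by omega) (by positivity), padicValNat.prime_pow,
    padicValNat.eq_zero_of_not_dvd (by omega), zero_add]

theorem hanoi_eq_iff_dvd_sub {u x : ℕ} (hx : u < x) :
    hanoi x = hanoi u ↔ 2 ^ (hanoi u + 1) ∣ x - u := by
  have hu := hanoi_spec u
  constructor
  · intro e
    have hx' := hanoi_spec x
    rw [e] at hx'
    refine ⟨x / 2 ^ (hanoi u + 1) - u / 2 ^ (hanoi u + 1), ?_⟩
    have hle : u / 2 ^ (hanoi u + 1) ≤ x / 2 ^ (hanoi u + 1) := Nat.div_le_div_right hx.le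
    generalize x / 2 ^ (hanoi u + 1) = p at hx' hle ⊢
    generalize u / 2 ^ (hanoi u + 1) = q at hu hle ⊢
    rw [pow_succ]
    zify [hle, hx.le] at hx' hu ⊢
    linear_combination hx' - hu
  · rintro ⟨k, hk⟩
    refine hanoi_eq_of_succ_eq (q := u / 2 ^ (hanoi u + 1) + k) ?_
    have : x = u + 2 ^ (hanoi u + 1) * k := by omega
    generalize u / 2 ^ (hanoi u + 1) = q at hu
    rw [this, add_right_comm, hu, pow_succ]
    ring

theorem card_later_instances {u T : ℕ} (hu : u < T) :
    ((Finset.Ioo u T).filter (fun v => hanoi v = hanoi u)).card =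
      (T - 1 - u) / 2 ^ (hanoi u + 1) := by
  rw [← Nat.Ioc_filter_dvd_card_eq_div]
  refine Finset.card_nbij' (fun x => x - u) (fun y => y + u) ?_ ?_ ?_ ?_
  · intro x hx
    simp only [Finset.coe_filter, Finset.mem_Ioo, Set.mem_ofPred_eq, Finset.mem_Ioc] at hx ⊢
    exact ⟨by omega, (hanoi_eq_iff_dvd_sub hx.1.1).1 hx.2⟩
  · intro y hy
    simp only [Finset.coe_filter, Finset.mem_Ioo, Set.mem_ofPred_eq, Finset.mem_Ioc] at hy ⊢
    exact ⟨by omega, (hanoi_eq_iff_dvd_sub (by omega)).2 (by simpa using hy.2)⟩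
  · intro x hx
    simp only [Finset.coe_filter, Finset.mem_Ioo, Set.mem_ofPred_eq] at hx
    show x - u + u = x
    omega
  · intro y _
    show y + u - u = y
    omega

theorem mem_lastInstances_iff {n h T u : ℕ} :
    u ∈ lastInstances n h T ↔ u < T ∧ hanoi u = h ∧ T ≤ u + n * 2 ^ (h + 1) := by
  constructor
  · rintro ⟨hu, rfl, hc⟩
    rw [card_later_instances hu, Nat.div_lt_iff_lt_mul (by positivity)] at hc
    exact ⟨hu, rfl, by omega⟩
  · rintro ⟨hu, rfl, hc⟩
    refine ⟨hu, rfl, ?_⟩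
    rw [card_later_instances hu, Nat.div_lt_iff_lt_mul (by positivity)]
    omega

/-! ### Gap sizes -/

/-- Take `v` of maximal hanoi value `h`. The times `v + 2^h` and, if it exists, `v - 2^h` have
larger value, hence lie outside the interval. -/
theorem exists_mem_Ico_gap_bound {a b : ℕ} (hab : a < b) :
    ∃ v, a ≤ v ∧ v < b ∧ b ≤ v + 2 ^ hanoi v ∧ b - a ≤ 2 ^ (hanoi v + 1) := by
  obtain ⟨v, hv, hmax⟩ := Finset.exists_max_image (Finset.Ico a b) hanoi ⟨a, by simp [hab]⟩
  rw [Finset.mem_Ico] at hv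
  have hpos : 0 < 2 ^ hanoi v := by positivity
  have not_mem : ∀ x k, x + 1 = 2 ^ (hanoi v + 1) * k → ¬ (a ≤ x ∧ x < b) := by
    intro x k hk hx
    have h1 := hmax x (by simpa using hx)
    have : 2 ^ (hanoi v + 1) ∣ x + 1 := ⟨k, hk⟩
    have h2 := (padicValNat_dvd_iff_le (p := 2) (by omega : x + 1 ≠ 0)).1 this
    have h3 : hanoi v + 1 ≤ hanoi x := h2
    omega
  have hs := hanoi_spec v
  set q := v / 2 ^ (hanoi v + 1)
  have h1 := not_mem (v + 2 ^ hanoi v) (q + 1) (by rw [add_right_comm, hs, pow_succ]; ring)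
  have h2 : v < a + 2 ^ hanoi v := by
    rcases Nat.eq_zero_or_pos q with h0 | h0
    · rw [h0] at hs; omega
    · have hle : 2 * 2 ^ hanoi v ≤ v := by nlinarith
      have := not_mem (v - 2 ^ hanoi v) q (by rw [pow_succ]; zify [(by omega : 2 ^ hanoi v ≤ v)] at hs ⊢; linear_combination hs)
      omega
  refine ⟨v, hv.1, hv.2, by omega, ?_⟩
  rw [pow_succ]
  omega

theorem cost_le_of_lastInstances_subset {n T : ℕ} {B : Set ℕ} (hn : 1 ≤ n)
    (hB : ∀ h, lastInstances n h T ⊆ B) : cost B T ≤ 1 / ((n : ℝ) - 1 / 2) := by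
  have hn' : (1 : ℝ) ≤ n := by exact_mod_cast hn
  refine Real.iSup_le (fun u => ?_) (by apply div_nonneg <;> linarith)
  have hu := u.2
  have huT : ((u : ℕ) : ℝ) + 2 ≤ T := by
    have : (u : ℕ) + 2 ≤ T := by omega
    exact_mod_cast this
  rw [div_le_div_iff₀ (by linarith) (by linarith), one_mul]
  obtain ⟨i, j, hg, hsub⟩ := (gapSize_isGreatest B T u).1
  rcases Nat.eq_zero_or_pos (i + j) with h0 | h0
  · rw [hg, h0]
    push_cast
    linarith
  have hmem : ∀ z : ℤ, (u : ℕ) - (i : ℤ) ≤ z → z < (u : ℕ) + j →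
      ∃ x : ℕ, x ∈ discarded B T ∧ (x : ℤ) = z := fun z h1 h2 => hsub ⟨h1, h2⟩
  obtain ⟨a, -, ha⟩ := hmem ((u : ℕ) - i) le_rfl (by omega)
  obtain ⟨v, hav, hvb, hb, hlen⟩ := exists_mem_Ico_gap_bound (a := a) (b := u + j) (by omega)
  obtain ⟨x, hx, hxv⟩ := hmem v (by omega) (by omega)
  obtain rfl : x = v := by exact_mod_cast hxv
  have hnot : x ∉ lastInstances n (hanoi x) T := fun h => hx.2 (hB _ h)
  rw [mem_lastInstances_iff] at hnot
  have hT : x + n * 2 ^ (hanoi x + 1) < T := by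
    by_contra hc
    exact hnot ⟨hx.1, rfl, by omega⟩
  have h1 : i + j ≤ 2 ^ (hanoi x + 1) := by omega
  -- The gap time `u` may exceed `x` by up to `2^h`, half a period: this is the `1/2` of the bound.
  have h2 : (u : ℕ) + n * 2 ^ (hanoi x + 1) + 1 ≤ T + 2 ^ hanoi x := by omega
  rw [hg]
  rw [pow_succ] at h1 h2
  have h1' : ((i + j : ℕ) : ℝ) ≤ 2 ^ hanoi x * 2 := by exact_mod_cast h1
  have h2' : ((u : ℕ) : ℝ) + n * (2 ^ hanoi x * 2) + 1 ≤ T + 2 ^ hanoi x := by exact_mod_cast h2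
  nlinarith

theorem cost_eq_zero_of_discarded_eq_empty {T : ℕ} {B : Set ℕ} (h : discarded B T = ∅) :
    cost B T = 0 := by
  have : ∀ u, gapSize B T u = 0 := by
    intro u
    obtain ⟨i, j, hg, hsub⟩ := (gapSize_isGreatest B T u).1
    rw [hg]
    by_contra hc
    have := hsub (show (u : ℤ) - i ∈ _ from ⟨le_rfl, by omega⟩)
    simp [h] at this
  simp [cost, this]

/-! ### Epochs and meta-epochs -/

/-- Monotonicity of `2^m - m`, free of truncated subtraction. -/
theorem pow_two_add_le {k m : ℕ} (h : k ≤ m) : 2 ^ k + m ≤ 2 ^ m + k := by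
  induction m, h using Nat.le_induction with
  | base => rfl
  | succ m _ ih => rw [pow_succ]; have := Nat.one_le_two_pow (n := m); omega

theorem metaEpoch_zero : metaEpoch 0 = 0 := by simp [metaEpoch]

theorem one_le_metaEpoch {t : ℕ} (ht : 1 ≤ t) : 1 ≤ metaEpoch t := by
  rw [metaEpoch, if_neg (by omega)]
  exact Nat.le_findGreatest ht (by simpa using ht)

theorem pow_metaEpoch_le {t : ℕ} (ht : 1 ≤ t) : 2 ^ metaEpoch t ≤ t + metaEpoch t := by
  have h1 := one_le_metaEpoch ht
  rw [metaEpoch, if_neg (by omega)] at h1 ⊢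
  have : 2 ^ _ - _ ≤ t :=
    Nat.findGreatest_of_ne_zero (P := fun m => 2 ^ m - m ≤ t) (n := t) rfl (by omega)
  omega

theorem lt_pow_metaEpoch_succ (t : ℕ) : t + metaEpoch t + 1 < 2 ^ (metaEpoch t + 1) := by
  rcases Nat.eq_zero_or_pos t with rfl | ht
  · simp [metaEpoch_zero]
  rw [metaEpoch, if_neg (by omega)]
  set m := Nat.findGreatest (fun m => 2 ^ m - m ≤ t) t with hm
  by_cases hmt : m + 1 ≤ t
  · have : ¬ 2 ^ _ - _ ≤ t := Nat.findGreatest_is_greatest (P := fun m => 2 ^ m - m ≤ t) (n := t)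
      (show _ < m + 1 by omega) hmt
    omega
  · have h1 : m ≤ t := Nat.findGreatest_le t
    have h2 : m < 2 ^ m := Nat.lt_two_pow_self
    rw [pow_succ]
    omega

theorem metaEpoch_mono {t t' : ℕ} (h : t ≤ t') : metaEpoch t ≤ metaEpoch t' := by
  by_contra! hc
  rcases Nat.eq_zero_or_pos t with rfl | ht
  · simp [metaEpoch_zero] at hc
  have h1 := pow_metaEpoch_le ht
  have h2 := lt_pow_metaEpoch_succ t'
  have h3 := pow_two_add_le (Nat.succ_le_of_lt hc)
  simp only [Nat.succ_eq_add_one] at h3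
  omega

theorem metaEpoch_eq {t m : ℕ} (h1 : 1 ≤ t) (h2 : 2 ^ m ≤ t + m) (h3 : t + m + 1 < 2 ^ (m + 1)) :
    metaEpoch t = m := by
  have h4 := pow_metaEpoch_le h1
  have h5 := lt_pow_metaEpoch_succ t
  rcases lt_trichotomy (metaEpoch t) m with h | h | h
  · have := pow_two_add_le (Nat.succ_le_of_lt h)
    simp only [Nat.succ_eq_add_one] at this
    omega
  · exact h
  · have := pow_two_add_le (Nat.succ_le_of_lt h)
    simp only [Nat.succ_eq_add_one] at this
    omega

theorem lt_pow_epoch (s T : ℕ) : T < 2 ^ (s + epoch s T) := by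
  rw [epoch]
  split_ifs with h
  · have h1 : s ≤ Nat.log 2 T := Nat.le_log_of_pow_le (by omega) h
    have := Nat.lt_pow_succ_log_self (b := 2) (by omega) T
    convert this using 2
    omega
  · simpa using h

theorem pow_epoch_le {s T : ℕ} (h : 1 ≤ epoch s T) : 2 ^ (s + epoch s T - 1) ≤ T := by
  rw [epoch] at h ⊢
  split_ifs at h ⊢ with h0
  swap
  · omega
  have h1 : s ≤ Nat.log 2 T := Nat.le_log_of_pow_le (by omega) h0
  have hT : T ≠ 0 := by have := Nat.one_le_two_pow (n := s); omega
  convert Nat.pow_log_le_self 2 hT using 2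
  omega

theorem epoch_mono (s : ℕ) {T T' : ℕ} (h : T ≤ T') : epoch s T ≤ epoch s T' := by
  unfold epoch
  have := Nat.log_mono_right (b := 2) h
  split_ifs <;> omega

/-- Meta-epoch `s` would begin at epoch `2^s - s`, whose first time is `2^(2^s - 1)`, exactly the
bound on `T`. -/
theorem metaEpoch_epoch_lt {s T : ℕ} (hs : 1 ≤ s) (hT : T < 2 ^ (2 ^ s - 1)) :
    metaEpoch (epoch s T) < s := by
  rcases Nat.eq_zero_or_pos (epoch s T) with h0 | h0
  · rw [h0, metaEpoch_zero]; omega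
  by_contra! hc
  have h1 := pow_two_add_le hc
  have h2 := pow_metaEpoch_le h0
  have h3 := (Nat.pow_lt_pow_iff_right (by omega : 1 < 2)).1 ((pow_epoch_le h0).trans_lt hT)
  omega

/-! ### Segments -/

theorem segSize_two_pow_mul_odd (s a k : ℕ) : segSize s (2 ^ a * (2 * k + 1)) = a + 1 := by
  obtain ⟨j, hj⟩ : ∃ j, 2 ^ a * (2 * k + 1) = j + 1 :=
    Nat.exists_eq_succ_of_ne_zero (by positivity)
  rw [hj, segSize, hanoi_eq_of_succ_eq (q := k) (h := a) (by rw [← hj, mul_comm])]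

theorem segStart_succ (s i : ℕ) : segStart s (i + 1) = segStart s i + segSize s i :=
  Finset.sum_range_succ _ _

theorem segStart_mono (s : ℕ) : Monotone (segStart s) :=
  monotone_nat_of_le_succ fun i => by rw [segStart_succ]; omega

/-- Induction by halving the block: the middle segment sits at an odd multiple of `2^m` and so has
size `m + 1`. This measures the room between a segment and the next survivor. -/
theorem segStart_add_two_pow (s : ℕ) {m i : ℕ} (hi : 2 ^ m ∣ i) :
    segStart s (i + 2 ^ m) + 2 + m = segStart s i + segSize s i + 2 ^ (m + 1) := by
  induction m generalizing i with
  | zero => rw [pow_zero, segStart_succ]; rfl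
  | succ m ih =>
    have h1 := ih ((pow_dvd_pow 2 (Nat.le_succ m)).trans hi)
    have h2 : 2 ^ m ∣ i + 2 ^ m := ((pow_dvd_pow 2 (Nat.le_succ m)).trans hi).add dvd_rfl
    have h3 := ih h2
    obtain ⟨k, rfl⟩ := hi
    rw [show 2 ^ (m + 1) * k + 2 ^ m = 2 ^ m * (2 * k + 1) by ring,
      segSize_two_pow_mul_odd] at h3
    rw [show 2 ^ (m + 1) * k + 2 ^ (m + 1) = 2 ^ m * (2 * k + 1) + 2 ^ m by ring]
    rw [show 2 ^ (m + 1) * k + 2 ^ m = 2 ^ m * (2 * k + 1) by ring] at h1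
    rw [pow_succ 2 (m + 1)]
    omega

theorem segStart_half {s : ℕ} (hs : 1 ≤ s) : segStart s (2 ^ (s - 1)) = 2 ^ s := by
  have h := segStart_add_two_pow s (m := s - 1) (dvd_zero _)
  rw [zero_add, Nat.sub_add_cancel hs] at h
  have h0 : segStart s 0 = 0 := Finset.sum_range_zero _
  have h1 : segSize s 0 = s + 1 := rfl
  omega

theorem segIndex_zero (s : ℕ) : segIndex s 0 = 0 := by simp [segIndex]

/-- The fill order is that of the fractional parts of the odd multiples of powers of two. -/
theorem segIndex_spec {s b : ℕ} (hb : b ≠ 0) (hbs : b < 2 ^ (s - 1)) :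
    ∃ a k, segIndex s b = 2 ^ a * (2 * k + 1) ∧
      (2 * b + 1) * 2 ^ a = 2 ^ (s - 1) + segIndex s b ∧ segIndex s b < 2 ^ (s - 1) := by
  have h1 : Nat.size b ≤ s - 1 := Nat.size_le.2 hbs
  have h2 : 0 < Nat.size b := Nat.size_pos.2 (by omega)
  have h3 : 2 ^ (Nat.size b - 1) ≤ b := Nat.lt_size.1 (by omega)
  have e1 : 2 ^ s / 2 ^ Nat.size b = 2 ^ (s - 1 - Nat.size b) * 2 := by
    rw [Nat.pow_div (by omega) (by omega), ← pow_succ]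
    congr 1
    omega
  have e2 : 2 ^ (s - 1) = 2 ^ (s - 1 - Nat.size b) * 2 * 2 ^ (Nat.size b - 1) := by
    rw [← pow_succ, ← pow_add]
    congr 1
    omega
  have e3 : segIndex s b =
      2 ^ (s - 1 - Nat.size b) * (2 * (b - 2 ^ (Nat.size b - 1)) + 1) := by
    rw [segIndex, if_neg hb, e1, Nat.mul_div_cancel _ (by omega)]
    ring
  have h4 : b < 2 ^ (Nat.size b - 1) * 2 := by
    rw [← pow_succ, Nat.sub_add_cancel h2]
    exact Nat.lt_size_self b
  refine ⟨_, _, e3, ?_, ?_⟩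
  · rw [e3, e2]
    zify [h3]
    ring
  · rw [e3, e2, mul_assoc]
    exact Nat.mul_lt_mul_of_pos_left (by omega) (by positivity)

theorem segIndex_lt {s b : ℕ} (hbs : b < 2 ^ (s - 1)) : segIndex s b < 2 ^ (s - 1) := by
  rcases eq_or_ne b 0 with rfl | hb
  · rwa [segIndex_zero]
  obtain ⟨a, k, -, -, h⟩ := segIndex_spec hb hbs
  exact h

theorem segIndex_injOn {s b b' : ℕ} (hb : b < 2 ^ (s - 1)) (hb' : b' < 2 ^ (s - 1))
    (e : segIndex s b = segIndex s b') : b = b' := by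
  rcases eq_or_ne b 0 with rfl | h0 <;> rcases eq_or_ne b' 0 with rfl | h0'
  · rfl
  · obtain ⟨a, k, hi, -⟩ := segIndex_spec h0' hb'
    rw [← e, segIndex_zero] at hi
    exact absurd hi (by positivity)
  · obtain ⟨a, k, hi, -⟩ := segIndex_spec h0 hb
    rw [e, segIndex_zero] at hi
    exact absurd hi (by positivity)
  · obtain ⟨a, k, hi, h, -⟩ := segIndex_spec h0 hb
    obtain ⟨a', k', hi', h', -⟩ := segIndex_spec h0' hb'
    have ha : a = a' := by
      have h1 := segSize_two_pow_mul_odd s a k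
      have h2 := segSize_two_pow_mul_odd s a' k'
      rw [← hi] at h1
      rw [← hi', ← e] at h2
      omega
    subst ha
    rw [← e, ← h] at h'
    have := Nat.eq_of_mul_eq_mul_right (by positivity) h'
    omega

/-! ### Positions in use -/

/-- `Valid s t m i h` says that in epoch `t` of meta-epoch `m` offset `h` of the segment of index
`i` is in use. -/
def Valid (s t m i h : ℕ) : Prop :=
  (2 ^ m ∣ i ∧ h < segSize s i + t) ∨
    ∃ k, 2 * i = 2 ^ m * (2 * k + 1) ∧ t + m < h + 2 ^ m ∧ h + 1 < 2 ^ m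

/-- Between survivors there is room for `2^(m+1) - m - 2 ≥ t` additional sites. A survivor has
reached offset `t - (2^m - m)` of the invaded segment, just below the offsets still valid there, and
that segment has `2^m - 1` sites before the next survivor. -/
theorem Valid.segStart_add_lt {s t m i i' h h' : ℕ} (ht : t + m + 1 < 2 ^ (m + 1))
    (hv : Valid s t m i h) (hv' : Valid s t m i' h') (hi : i < i') :
    segStart s i + h < segStart s i' + h' := by
  rcases hv with ⟨hd, hh⟩ | ⟨k, hk, -, hh⟩
  · have hstep := segStart_add_two_pow s hd
    by_cases hle : i + 2 ^ m ≤ i'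
    · have := segStart_mono s hle
      omega
    rcases hv' with ⟨hd', -⟩ | ⟨k', hk', hh', -⟩
    · obtain ⟨c, rfl⟩ := hd
      obtain ⟨c', rfl⟩ := hd'
      have hc := Nat.lt_of_mul_lt_mul_left hi
      have := Nat.mul_le_mul_left (2 ^ m) (Nat.succ_le_of_lt hc)
      rw [Nat.succ_eq_add_one, mul_add, mul_one] at this
      omega
    · obtain ⟨c, rfl⟩ := hd
      obtain ⟨n, rfl⟩ : ∃ n, m = n + 1 := by
        rcases m with _ | n
        · omega
        · exact ⟨n, rfl⟩
      have e : i' = 2 ^ n * (2 * k' + 1) := by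
        rw [pow_succ] at hk'
        linarith
      have hpos : 0 < 2 ^ n := by positivity
      have e2 : 2 ^ (n + 1) * c + 2 ^ n = i' := by
        rw [e] at hle hi ⊢
        rw [pow_succ] at hle hi ⊢
        have h1 : c < k' + 1 := by by_contra; nlinarith
        have h2 : k' < c + 1 := by by_contra; nlinarith
        obtain rfl : c = k' := by omega
        ring
      have hstep' := segStart_add_two_pow s (m := n) (i := 2 ^ (n + 1) * c)
        (Dvd.dvd.mul_right (pow_dvd_pow 2 (Nat.le_succ n)) _)
      rw [e2] at hstep'
      omega
  · obtain ⟨n, rfl⟩ : ∃ n, m = n + 1 := by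
      rcases m with _ | n
      · omega
      · exact ⟨n, rfl⟩
    have e : i = 2 ^ n * (2 * k + 1) := by
      rw [pow_succ] at hk
      linarith
    have hstep := segStart_add_two_pow s (m := n) (i := i) ⟨_, e⟩
    rw [e, segSize_two_pow_mul_odd, ← e] at hstep
    have hle : i + 2 ^ n ≤ i' := by
      rcases hv' with ⟨⟨c, rfl⟩, -⟩ | ⟨k', hk', -⟩
      · rw [e, pow_succ] at hi ⊢
        have : k < c := by
          by_contra
          have hpos : 0 < 2 ^ n := by positivity
          nlinarith
        nlinarith
      · have e' : i' = 2 ^ n * (2 * k' + 1) := by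
          rw [pow_succ] at hk'
          linarith
        rw [e, e'] at hi ⊢
        have := Nat.lt_of_mul_lt_mul_left hi
        nlinarith
    have := segStart_mono s hle
    omega

theorem Valid.injective {s t m i i' h h' : ℕ} (ht : t + m + 1 < 2 ^ (m + 1))
    (hv : Valid s t m i h) (hv' : Valid s t m i' h')
    (e : segStart s i + h = segStart s i' + h') : i = i' ∧ h = h' := by
  rcases lt_trichotomy i i' with hi | rfl | hi
  · have := hv.segStart_add_lt ht hv' hi
    omega
  · exact ⟨rfl, by omega⟩
  · have := hv'.segStart_add_lt ht hv hi
    omega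

theorem Valid.segStart_add_lt_two_pow {s t m i h : ℕ} (hms : m < s)
    (ht : t + m + 1 < 2 ^ (m + 1)) (hv : Valid s t m i h) (hi : i < 2 ^ (s - 1)) :
    segStart s i + h < 2 ^ s := by
  -- Index `2^(s-1)` acts as a fictitious segment starting at the end of the buffer.
  have h0 := hv.segStart_add_lt (i' := 2 ^ (s - 1)) (h' := 0) ht ?_ hi
  · rwa [segStart_half (by omega)] at h0
  · have := segSize_two_pow_mul_odd s (s - 1) 0
    rw [mul_zero, zero_add, mul_one] at this
    exact Or.inl ⟨pow_dvd_pow 2 (by omega), by omega⟩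

/-- Since `(2b + 1) 2^a ≥ 2^(s-1)`, a small fill index `b` forces a large exponent `a`. -/
theorem two_pow_dvd_segIndex {s m b : ℕ} (hms : m < s) (hb : b < 2 ^ (s - 1 - m)) :
    2 ^ m ∣ segIndex s b := by
  rcases eq_or_ne b 0 with rfl | h0
  · rw [segIndex_zero]
    exact dvd_zero _
  have hbs : b < 2 ^ (s - 1) := hb.trans_le (Nat.pow_le_pow_right (by omega) (by omega))
  obtain ⟨a, k, hi, e, -⟩ := segIndex_spec h0 hbs
  rw [hi]
  refine Dvd.dvd.mul_right (pow_dvd_pow 2 ?_) _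
  by_contra! hc
  have h1 : 2 ^ (a + 1) * 2 ^ (s - 1 - m) ≤ 2 ^ (s - 1) := by
    rw [← pow_add]
    exact Nat.pow_le_pow_right (by omega) (by omega)
  have h2 : (2 * b + 1) * 2 ^ a < 2 ^ (a + 1) * 2 ^ (s - 1 - m) := by
    rw [pow_succ, mul_assoc, mul_comm]
    exact Nat.mul_lt_mul_of_pos_left (by omega) (by positivity)
  omega

/-- The segments of odd multiples of `2 ^ a` are those of fill order at least `2 ^ (s - 2 - a)`
and less than `2 ^ (s - 1 - a)`. -/
theorem segIndex_level {s b a i : ℕ} (hb : b ≠ 0) (e : (2 * b + 1) * 2 ^ a = 2 ^ (s - 1) + i)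
    (hi : i < 2 ^ (s - 1)) (hi0 : 0 < i) :
    a + 2 ≤ s ∧ 2 ^ (s - 1 - (a + 1)) ≤ b ∧ b < 2 * 2 ^ (s - 1 - (a + 1)) := by
  have ha : a < s - 1 := by
    by_contra! hc
    have := Nat.pow_le_pow_right (n := 2) (by omega) hc
    have : 3 * 2 ^ a ≤ (2 * b + 1) * 2 ^ a := Nat.mul_le_mul_right _ (by omega)
    omega
  have h1 : 2 ^ (s - 1) = 2 * 2 ^ (s - 1 - (a + 1)) * 2 ^ a := by
    rw [← pow_succ', ← pow_add]
    congr 1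
    omega
  generalize 2 ^ (s - 1 - (a + 1)) = P at h1 ⊢
  rw [h1] at e hi
  have hpos : 0 < 2 ^ a := by positivity
  have h2 : 2 * P < 2 * b + 1 := by
    refine Nat.lt_of_mul_lt_mul_right (a := 2 ^ a) ?_
    omega
  have h3 : 2 * b + 1 < 4 * P := by
    refine Nat.lt_of_mul_lt_mul_right (a := 2 ^ a) ?_
    rw [e]
    linarith
  omega

theorem segIndex_odd {s m b : ℕ} (hm : 1 ≤ m) (hms : m < s) (hb : 2 ^ (s - 1 - m) ≤ b)
    (hb' : b < 2 ^ (s - m)) : ∃ k, 2 * segIndex s b = 2 ^ m * (2 * k + 1) := by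
  have h0 : b ≠ 0 := by have := Nat.one_le_two_pow (n := s - 1 - m); omega
  have hbs : b < 2 ^ (s - 1) := hb'.trans_le (Nat.pow_le_pow_right (by omega) (by omega))
  obtain ⟨a, k, hi, e, hlt⟩ := segIndex_spec h0 hbs
  have hpos : 0 < segIndex s b := by rw [hi]; positivity
  obtain ⟨h1, h2, h3⟩ := segIndex_level h0 e hlt hpos
  rw [← pow_succ'] at h3
  have h4 := (Nat.pow_lt_pow_iff_right (by omega : 1 < 2)).1 (h2.trans_lt hb')
  have h5 := (Nat.pow_lt_pow_iff_right (by omega : 1 < 2)).1 (hb.trans_lt h3)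
  obtain rfl : m = a + 1 := by omega
  exact ⟨k, by rw [hi, pow_succ]; ring⟩

/-! ### Ring sizes and the placement of items -/

theorem ringSize_cases {s t : ℕ} (h : ℕ) (hms : metaEpoch t < s) :
    ringSize s t h = 2 ^ (s - 1 - metaEpoch t) ∨
      (ringSize s t h = 2 ^ (s - metaEpoch t) ∧ 1 ≤ metaEpoch t ∧
        t + metaEpoch t < h + 2 ^ metaEpoch t ∧ h + 1 < 2 ^ metaEpoch t) := by
  have key : ∀ k ≤ s, max 1 (2 ^ s / 2 ^ k) = 2 ^ (s - k) := fun k hk => by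
    rw [Nat.pow_div hk (by omega)]
    exact max_eq_right Nat.one_le_two_pow
  simp only [ringSize]
  have h1 := Nat.lt_two_pow_self (n := metaEpoch t)
  have h2 := pow_succ 2 (metaEpoch t)
  split_ifs with hc
  · right
    have hm : 1 ≤ metaEpoch t := by
      by_contra h0
      obtain h0 : metaEpoch t = 0 := by omega
      rw [h0] at hc
      omega
    rw [Nat.add_sub_cancel, key _ hms.le]
    exact ⟨rfl, hm, by omega, by omega⟩
  · left
    rw [Nat.sub_zero, key _ hms]
    congr 1
    omega

/-- Fill-order index of the segment in which the item `u` is stored. -/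
def bunch (s u : ℕ) : ℕ := u / 2 ^ (hanoi u + 1) % ringSize s (epoch s u) (hanoi u)

theorem site_eq (s u : ℕ) : site s u = segStart s (segIndex s (bunch s u)) + hanoi u := rfl

theorem exists_ringSize_eq {s t : ℕ} (h : ℕ) (hms : metaEpoch t < s) :
    ∃ r, ringSize s t h = 2 ^ r ∧ s - 1 - metaEpoch t ≤ r ∧ r ≤ s - 1 := by
  rcases ringSize_cases h hms with e | ⟨e, hm, -⟩
  · exact ⟨_, e, le_rfl, by omega⟩
  · exact ⟨_, e, by omega, by omega⟩

theorem bunch_lt {s u : ℕ} (hms : metaEpoch (epoch s u) < s) : bunch s u < 2 ^ (s - 1) := by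
  obtain ⟨r, hr, -, h⟩ := exists_ringSize_eq (hanoi u) hms
  rw [bunch, hr]
  exact (Nat.mod_lt _ (by positivity)).trans_le (Nat.pow_le_pow_right (by omega) h)

theorem bunch_mul_le (s u : ℕ) : (2 * bunch s u + 1) * 2 ^ hanoi u ≤ u + 1 := by
  have := Nat.mod_le (u / 2 ^ (hanoi u + 1)) (ringSize s (epoch s u) (hanoi u))
  conv_rhs => rw [hanoi_spec u]
  refine Nat.mul_le_mul_right _ ?_
  rw [bunch]
  omega

/-- From `(2b + 1) 2^h ≤ u + 1 ≤ 2^(s+t)` and `(2b + 1) 2^a > 2^(s-1)` follows `h ≤ a + t`, so a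
surviving segment has already grown to offset `h`. Other segments are used only by doubled rings,
that is, at offsets not yet invaded. -/
theorem valid_item {s u : ℕ} (hms : metaEpoch (epoch s u) < s) :
    Valid s (epoch s u) (metaEpoch (epoch s u)) (segIndex s (bunch s u)) (hanoi u) := by
  have hbs := bunch_lt hms
  have hle := bunch_mul_le s u
  have hut : u + 1 ≤ 2 ^ (s + epoch s u) := lt_pow_epoch s u
  by_cases hb : bunch s u < 2 ^ (s - 1 - metaEpoch (epoch s u))
  · refine Or.inl ⟨two_pow_dvd_segIndex hms hb, ?_⟩
    rcases eq_or_ne (bunch s u) 0 with h0 | h0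
    · rw [h0] at hle ⊢
      rw [segIndex_zero, segSize]
      have := (Nat.pow_le_pow_iff_right (by omega : 1 < 2)).1
        ((show 2 ^ hanoi u ≤ u + 1 by omega).trans hut)
      omega
    · obtain ⟨a, k, hi, e, -⟩ := segIndex_spec h0 hbs
      have hpos : 0 < segIndex s (bunch s u) := by rw [hi]; positivity
      have h1 : 2 ^ (s - 1 + hanoi u) < 2 ^ (s + epoch s u + a) := by
        rw [pow_add, pow_add _ _ a]
        calc 2 ^ (s - 1) * 2 ^ hanoi u
            < (2 ^ (s - 1) + segIndex s (bunch s u)) * 2 ^ hanoi u :=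
              Nat.mul_lt_mul_of_pos_right (by omega) (by positivity)
          _ = (2 * bunch s u + 1) * 2 ^ hanoi u * 2 ^ a := by rw [← e]; ring
          _ ≤ 2 ^ (s + epoch s u) * 2 ^ a := Nat.mul_le_mul_right _ (hle.trans hut)
      have h2 := (Nat.pow_lt_pow_iff_right (by omega : 1 < 2)).1 h1
      rw [hi, segSize_two_pow_mul_odd]
      omega
  · rcases ringSize_cases (hanoi u) hms with e | ⟨e, hm, h1, h2⟩
    · refine absurd ?_ hb
      rw [bunch, e]
      exact Nat.mod_lt _ (by positivity)
    · obtain ⟨k, hk⟩ := segIndex_odd hm hms (not_lt.1 hb)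
        (by rw [bunch, e]; exact Nat.mod_lt _ (by positivity))
      exact Or.inr ⟨k, hk, h1, h2⟩

theorem site_lt {s u : ℕ} (hms : metaEpoch (epoch s u) < s) : site s u < 2 ^ s :=
  (valid_item hms).segStart_add_lt_two_pow hms (lt_pow_metaEpoch_succ _)
    (segIndex_lt (bunch_lt hms))

/-! ### Overwriting -/

theorem exponent_eq_of_two_pow_mul_odd {a a' k k' : ℕ}
    (e : 2 ^ a * (2 * k + 1) = 2 ^ a' * (2 * k' + 1)) : a = a' := by
  have h1 := segSize_two_pow_mul_odd 0 a k
  have h2 := segSize_two_pow_mul_odd 0 a' k'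
  rw [e] at h1
  omega

theorem le_of_two_pow_dvd_two_pow_mul_odd {m a k : ℕ} (h : 2 ^ m ∣ 2 ^ a * (2 * k + 1)) :
    m ≤ a := by
  have hc : Nat.Coprime (2 ^ m) (2 * k + 1) := Nat.Coprime.pow_left _ (by simp)
  exact (Nat.pow_dvd_pow_iff_le_right (by omega)).1 (hc.dvd_of_dvd_mul_right h)

/-- If two items are stored at the same offset of the same segment, then at least one full cycle of
the smaller ring separates them. -/
theorem le_of_bunch_eq {s u u' : ℕ} (hlt : u < u') (hms : metaEpoch (epoch s u') < s)
    (hb : bunch s u = bunch s u') (hh : hanoi u = hanoi u') :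
    u + 2 ^ (s - 1 - metaEpoch (epoch s u')) * 2 ^ (hanoi u + 1) ≤ u' := by
  have hmono := metaEpoch_mono (epoch_mono s hlt.le)
  obtain ⟨r, hr, hr1, -⟩ := exists_ringSize_eq (hanoi u) (hmono.trans_lt hms)
  obtain ⟨r', hr', hr1', -⟩ := exists_ringSize_eq (hanoi u') hms
  have hu := hanoi_spec u
  have hu' := hanoi_spec u'
  rw [bunch, bunch, hr, hr'] at hb
  rw [← hh] at hb hu'
  have hmod : u / 2 ^ (hanoi u + 1) ≡ u' / 2 ^ (hanoi u + 1)
      [MOD 2 ^ (s - 1 - metaEpoch (epoch s u'))] := by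
    have h1 := (Nat.mod_modEq (u / 2 ^ (hanoi u + 1)) (2 ^ r)).of_dvd
      (pow_dvd_pow 2 (show s - 1 - metaEpoch (epoch s u') ≤ r by omega))
    have h2 := (Nat.mod_modEq (u' / 2 ^ (hanoi u + 1)) (2 ^ r')).of_dvd
      (pow_dvd_pow 2 hr1')
    rw [hb] at h1
    exact h1.symm.trans h2
  generalize u / 2 ^ (hanoi u + 1) = q at *
  generalize u' / 2 ^ (hanoi u + 1) = q' at *
  have hq : q < q' := by
    by_contra! hc
    have := Nat.mul_le_mul_right (2 ^ hanoi u) (show 2 * q' + 1 ≤ 2 * q + 1 by omega)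
    omega
  have hadd := hmod.add_le_of_lt hq
  have := Nat.mul_le_mul_right (2 ^ hanoi u)
    (show 2 * (q + 2 ^ (s - 1 - metaEpoch (epoch s u'))) + 1 ≤ 2 * q' + 1 by omega)
  rw [pow_succ]
  nlinarith

/-- The ring size is a power of two above `2^r`, hence a multiple of `2 * 2^r`. -/
theorem exists_eq_bunch_add {s u r : ℕ} (hms : metaEpoch (epoch s u) < s)
    (hr : 2 ^ r ≤ bunch s u) : ∃ d, u / 2 ^ (hanoi u + 1) = bunch s u + 2 * 2 ^ r * d := by
  obtain ⟨r', hr', -⟩ := exists_ringSize_eq (hanoi u) hms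
  rw [bunch, hr'] at hr ⊢
  have h1 := (Nat.pow_lt_pow_iff_right (by omega : 1 < 2)).1
    (hr.trans_lt (Nat.mod_lt _ (by positivity)))
  obtain ⟨f, hf⟩ := pow_dvd_pow 2 (Nat.succ_le_of_lt h1)
  generalize u / 2 ^ (hanoi u + 1) = q
  refine ⟨f * (q / 2 ^ r'), ?_⟩
  have h2 := Nat.mod_add_div q (2 ^ r')
  rw [← pow_succ', ← mul_assoc, ← Nat.succ_eq_add_one, ← hf]
  exact h2.symm

/-- The bound on `q` forces `d < E`, so `2(q + P) + 1 ≤ 4PE + 2(b - P) + 1`, and the excess over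
`4PE` is at most `4E(b - P)`. -/
theorem cycle_bound {P E b q d : ℕ} (hE : 1 ≤ E) (hb : P < b) (hd : q = b + 2 * P * d)
    (hq : 2 * q + 1 ≤ P * (4 * E)) : 2 * (q + P) + 1 ≤ b * (4 * E) := by
  obtain ⟨j, rfl⟩ : ∃ j, b = P + (j + 1) := ⟨b - P - 1, by omega⟩
  have hdE : d < E := by
    by_contra! hc
    have := Nat.mul_le_mul_left P hc
    nlinarith
  have h1 := Nat.mul_le_mul_left P (Nat.succ_le_of_lt hdE)
  have h2 := Nat.mul_le_mul_left (j + 1) hE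
  rw [Nat.succ_eq_add_one] at h1
  nlinarith

set_option maxHeartbeats 1000000 in
/-- An item is overwritten only after `2 ^ (s - 1 - m)` further items of its hanoi value, where `m`
is the current meta-epoch. -/
theorem le_of_site_eq {s u u' : ℕ} (hlt : u < u') (hms' : metaEpoch (epoch s u') < s)
    (hsite : site s u = site s u') :
    u + 2 ^ (s - 1 - metaEpoch (epoch s u')) * 2 ^ (hanoi u + 1) ≤ u' := by
  have htt := epoch_mono s hlt.le
  have hmm := metaEpoch_mono htt
  have hms := hmm.trans_lt hms'
  have hv := valid_item hms
  have hv' := valid_item hms'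
  have ht := lt_pow_metaEpoch_succ (epoch s u)
  have ht' := lt_pow_metaEpoch_succ (epoch s u')
  have hb := bunch_lt hms
  have hb' := bunch_lt hms'
  rw [site_eq, site_eq] at hsite
  by_cases hval : Valid s (epoch s u') (metaEpoch (epoch s u')) (segIndex s (bunch s u)) (hanoi u)
  · obtain ⟨h1, h2⟩ := hval.injective ht' hv' hsite
    exact le_of_bunch_eq hlt hms' (segIndex_injOn hb hb' h1) h2
  -- A segment earlier in fill order would still survive, and survivors never lose offsets.
  have hP' : 2 ^ (s - 1 - metaEpoch (epoch s u')) ≤ bunch s u := by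
    by_contra! hc
    refine hval (Or.inl ⟨two_pow_dvd_segIndex hms' hc, ?_⟩)
    rcases hv with ⟨-, h⟩ | ⟨k, hk, -⟩
    · omega
    · obtain ⟨c, hc'⟩ := two_pow_dvd_segIndex hms
        (hc.trans_le (Nat.pow_le_pow_right (by omega) (by omega)))
      rw [hc', mul_left_comm] at hk
      have := Nat.eq_of_mul_eq_mul_left (by positivity) hk
      omega
  have h0 : bunch s u ≠ 0 := by
    have := Nat.one_le_two_pow (n := s - 1 - metaEpoch (epoch s u'))
    omega
  obtain ⟨a, k, hi, e, hilt⟩ := segIndex_spec h0 hb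
  obtain ⟨has, hbP, hb2P⟩ := segIndex_level h0 e hilt (by rw [hi]; positivity)
  have hMm : a + 1 ≤ metaEpoch (epoch s u') := by
    rw [← pow_succ'] at hb2P
    have := (Nat.pow_lt_pow_iff_right (by omega : 1 < 2)).1 (hP'.trans_lt hb2P)
    omega
  have ht1 : 1 ≤ epoch s u' := by
    by_contra hc
    obtain hc : epoch s u' = 0 := by omega
    rw [hc, metaEpoch_zero] at hMm
    omega
  -- offset `h` of the segment is in use up to epoch `2 ^ (a + 1) - (a + 1) + h`
  obtain ⟨hh, hth⟩ : hanoi u + 1 < 2 ^ (a + 1) ∧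
      epoch s u + (a + 1) < hanoi u + 2 ^ (a + 1) := by
    rcases hv with ⟨hd, h⟩ | ⟨k', hk', h1, h2⟩
    · rw [hi] at hd h
      rw [segSize_two_pow_mul_odd] at h
      have h1 := le_of_two_pow_dvd_two_pow_mul_odd hd
      have h2 := pow_two_add_le (show metaEpoch (epoch s u) + 1 ≤ a + 1 by omega)
      omega
    · rw [hi, ← mul_assoc, ← pow_succ'] at hk'
      rw [exponent_eq_of_two_pow_mul_odd hk']
      exact ⟨h2, h1⟩
  have hE : hanoi u + 2 ^ (a + 1) ≤ epoch s u' + (a + 1) := by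
    by_contra! hc
    rcases eq_or_lt_of_le hMm with hM | hM
    · refine hval (Or.inr ⟨k, ?_, ?_, ?_⟩)
      · rw [hi, ← hM, pow_succ]
        ring
      · rwa [← hM]
      · rwa [← hM]
    · have h1 := pow_two_add_le (show a + 1 + 1 ≤ metaEpoch (epoch s u') by omega)
      have h2 := pow_metaEpoch_le ht1
      rw [pow_succ 2 (a + 1)] at h1
      omega
  have hPP : 2 ^ (s - 1 - metaEpoch (epoch s u')) ≤ 2 ^ (s - 1 - (a + 1)) :=
    Nat.pow_le_pow_right (by omega) (by omega)
  -- With `P = 2^(s-1-(a+1))`, the number `P * 4E * 2^h` is the first time of epoch `h + 2^(a+1) -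
  -- (a+1)`, in which offset `h` is invaded. Item `u` precedes it; twice this time is late enough
  -- for `u'` (`far`).
  obtain ⟨E, hEpos, hC⟩ : ∃ E, 1 ≤ E ∧ 2 ^ 2 ^ (a + 1) = 4 * E := by
    refine ⟨2 ^ (2 ^ (a + 1) - 2), Nat.one_le_two_pow, ?_⟩
    rw [show 4 = 2 ^ 2 by rfl, ← pow_add]
    congr 1
    have := Nat.one_le_two_pow (n := a)
    rw [pow_succ]
    omega
  have hPM : 2 ^ (s - 1 - (a + 1)) * 2 ^ (a + 1) = 2 ^ (s - 1) := by
    rw [← pow_add]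
    congr 1
    omega
  -- scaling of powers of two by the level of the segment
  have scale : ∀ x y, x + (a + 1) = s - 1 + hanoi u + 2 ^ (a + 1) + y →
      2 ^ x = 2 ^ (s - 1 - (a + 1)) * (4 * E) * 2 ^ y * 2 ^ hanoi u := by
    intro x y hxy
    refine Nat.eq_of_mul_eq_mul_right (show 0 < 2 ^ (a + 1) by positivity) ?_
    rw [← pow_add, hxy, ← hC, pow_add, pow_add, pow_add, ← hPM]
    ring
  have hu := hanoi_spec u
  set q := u / 2 ^ (hanoi u + 1) with hq
  set P := 2 ^ (s - 1 - (a + 1)) with hPdef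
  have hpos : 0 < 2 ^ hanoi u := by positivity
  have hPpos : 0 < P := by positivity
  have hqlt : 2 * q + 1 ≤ P * (4 * E) := by
    refine Nat.le_of_mul_le_mul_right (c := 2 ^ hanoi u) ?_ hpos
    rw [← hu]
    calc u + 1 ≤ 2 ^ (s + epoch s u) := lt_pow_epoch s u
      _ ≤ 2 ^ (s - 1 + hanoi u + 2 ^ (a + 1) - (a + 1)) :=
        Nat.pow_le_pow_right (by omega) (by omega)
      _ = P * (4 * E) * 2 ^ hanoi u := by
        rw [scale _ 0 (by omega)]
        ring
  suffices h : (2 * (q + P) + 1) * 2 ^ hanoi u ≤ u' + 1 by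
    have := Nat.mul_le_mul_right (2 ^ hanoi u) hPP
    rw [pow_succ]
    nlinarith
  have far : P * (4 * E) * 2 * 2 ^ hanoi u ≤ u' + 1 →
      (2 * (q + P) + 1) * 2 ^ hanoi u ≤ u' + 1 := by
    intro h
    refine le_trans (Nat.mul_le_mul_right _ ?_) h
    nlinarith
  rcases eq_or_lt_of_le hE with hE | hE
  swap
  -- Every later epoch starts at no less than twice the invasion time.
  · refine far ?_
    have h1 := pow_epoch_le ht1
    have h2 : 2 ^ (s - 1 + hanoi u + 2 ^ (a + 1) + 1 - (a + 1)) ≤ 2 ^ (s + epoch s u' - 1) :=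
      Nat.pow_le_pow_right (by omega) (by omega)
    rw [scale _ 1 (by omega), pow_one] at h2
    omega
  have hM : metaEpoch (epoch s u') = a + 1 :=
    metaEpoch_eq ht1 (by omega) (by rw [pow_succ 2 (a + 1)]; omega)
  -- the invading segment is the one before
  have hstep := segStart_add_two_pow s (m := a) (i := 2 ^ (a + 1) * k)
    (Dvd.dvd.mul_right (pow_dvd_pow 2 (Nat.le_succ a)) _)
  rw [show 2 ^ (a + 1) * k + 2 ^ a = segIndex s (bunch s u) by rw [hi]; ring] at hstep
  -- In this epoch the last site of the invader is offset `h` of the segment of `u`, which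
  -- determines the segment and hanoi value of `u'`.
  obtain ⟨hi', hh'⟩ := Valid.injective (i := 2 ^ (a + 1) * k)
    (h := segSize s (2 ^ (a + 1) * k) + epoch s u' - 1) ht'
    (Or.inl ⟨by rw [hM]; exact ⟨k, rfl⟩, by omega⟩) hv' (by omega)
  have hle' := bunch_mul_le s u'
  rcases eq_or_ne (bunch s u') 0 with hb0 | hb0
  · refine far ?_
    rw [hb0, segIndex_zero] at hi'
    rw [hi', segSize] at hh'
    rw [hb0, mul_zero, zero_add, one_mul, ← hh', scale _ 1 (by omega), pow_one] at hle'
    exact hle'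
  obtain ⟨a', k', hia', e', -⟩ := segIndex_spec hb0 hb'
  have hk0 : 0 < 2 ^ (a + 1) * k := by rw [hi', hia']; positivity
  have hsz : segSize s (2 ^ (a + 1) * k) = a' + 1 := by
    rw [hi', hia', segSize_two_pow_mul_odd]
  -- That is, `bunch s u = P + k`.
  have e2 : bunch s u * 2 ^ (a + 1) = P * 2 ^ (a + 1) + 2 ^ (a + 1) * k := by
    rw [hPM]
    rw [hi] at e
    rw [pow_succ]
    linarith
  -- The lower bound on `u'` grows in proportion to the fill index of the invaded segment: segments
  -- filled later are invaded later.
  have hbig : bunch s u * (4 * E) * 2 ^ hanoi u ≤ u' + 1 := by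
    rw [← hh', hsz, show a' + 1 + epoch s u' - 1 = a' + epoch s u' by omega] at hle'
    calc bunch s u * (4 * E) * 2 ^ hanoi u
        = bunch s u * 2 ^ (hanoi u + 2 ^ (a + 1)) := by rw [pow_add, hC]; ring
      _ = bunch s u * 2 ^ (a + 1) * 2 ^ epoch s u' := by rw [hE, pow_add]; ring
      _ = (2 * bunch s u' + 1) * 2 ^ a' * 2 ^ epoch s u' := by rw [e2, hPM, e', hi']
      _ = (2 * bunch s u' + 1) * 2 ^ (a' + epoch s u') := by rw [pow_add]; ring
      _ ≤ u' + 1 := hle'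
  refine le_trans (Nat.mul_le_mul_right _ ?_) hbig
  obtain ⟨d, hd⟩ := exists_eq_bunch_add hms hbP
  refine cycle_bound hEpos ?_ hd hqlt
  refine Nat.lt_of_mul_lt_mul_right (a := 2 ^ (a + 1)) ?_
  omega

/-! ### Retained items and their number -/

theorem buffer_eq_some {s u T : ℕ} (hu : u < T)
    (h : ∀ u', u < u' → u' < T → site s u' ≠ site s u) : buffer s T (site s u) = some u := by
  induction T with
  | zero => omega
  | succ T ih =>
    rw [buffer]
    rcases eq_or_lt_of_le (Nat.lt_succ_iff.1 hu) with rfl | hlt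
    · exact Function.update_self ..
    · rw [Function.update_of_ne (h T hlt (by omega)).symm]
      exact ih hlt fun u' h1 h2 => h u' h1 (by omega)

theorem lastInstances_subset_retained {s T : ℕ} (hms : metaEpoch (epoch s T) < s) (h : ℕ) :
    lastInstances (2 ^ (s - 1 - metaEpoch (epoch s T))) h T ⊆ retained s T := by
  intro u hu
  obtain ⟨huT, rfl, hT⟩ := mem_lastInstances_iff.1 hu
  have hlt : ∀ u' ≤ T, metaEpoch (epoch s u') ≤ metaEpoch (epoch s T) :=
    fun u' h' => metaEpoch_mono (epoch_mono s h')
  refine ⟨site s u, site_lt ((hlt u huT.le).trans_lt hms),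
    buffer_eq_some huT fun u' h1 h2 hsite => ?_⟩
  have hm' := hlt u' h2.le
  have h3 := le_of_site_eq h1 (hm'.trans_lt hms) hsite.symm
  have h4 := Nat.mul_le_mul_right (2 ^ (hanoi u + 1)) (Nat.pow_le_pow_right (n := 2) (by omega)
    (show s - 1 - metaEpoch (epoch s T) ≤ s - 1 - metaEpoch (epoch s u') by omega))
  omega

/-- In epoch `0` the last `2^(s-1)` items of any value reach back at least `2^s > T`. -/
theorem discarded_retained_eq_empty {s T : ℕ} (hs : 1 ≤ s) (h : epoch s T = 0) :
    discarded (retained s T) T = ∅ := by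
  refine Set.eq_empty_of_forall_notMem fun u hu => hu.2 ?_
  have hm : metaEpoch (epoch s T) = 0 := by rw [h, metaEpoch_zero]
  refine lastInstances_subset_retained (by omega) (hanoi u) (mem_lastInstances_iff.2
    ⟨hu.1, rfl, ?_⟩)
  have h1 := lt_pow_epoch s T
  rw [hm, ← pow_add]
  have : 2 ^ (s + epoch s T) ≤ 2 ^ (s - 1 - 0 + (hanoi u + 1)) :=
    Nat.pow_le_pow_right (by omega) (by omega)
  omega

/-- In meta-epoch `m` the number `2 ^ s / 2 ^ (m + 1)` dominates both other estimates of the number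
of retained instances. -/
theorem max_instances_eq {s t : ℕ} (ht : 1 ≤ t) (hms : metaEpoch t < s) :
    max (max ((2 : ℝ) ^ s / (2 * ((t : ℝ) + s))) ((2 : ℝ) ^ s / (4 * (t : ℝ))))
      ((2 : ℝ) ^ s / 2 ^ (metaEpoch t + 1)) = ((2 ^ (s - 1 - metaEpoch t) : ℕ) : ℝ) := by
  have h1 := pow_metaEpoch_le ht
  -- With `2^τ ≤ t + τ` this gives `2^τ ≤ 2t`, the comparison with `S / (4t)`.
  have h2 : 2 * metaEpoch t ≤ 2 ^ metaEpoch t := by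
    rcases metaEpoch t with _ | n
    · simp
    · have := Nat.lt_two_pow_self (n := n)
      rw [pow_succ]
      omega
  have h3 : ((2 ^ (metaEpoch t + 1) : ℕ) : ℝ) ≤ ((2 * (t + s) : ℕ) : ℝ) := by
    rw [pow_succ]
    exact_mod_cast (by omega)
  have h4 : ((2 ^ (metaEpoch t + 1) : ℕ) : ℝ) ≤ ((4 * t : ℕ) : ℝ) := by
    rw [pow_succ]
    exact_mod_cast (by omega)
  push_cast at h3 h4
  rw [max_eq_right]
  · push_cast
    rw [div_eq_iff (by positivity), ← pow_add]
    congr 1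
    omega
  · refine max_le ?_ ?_ <;> gcongr

end Tilted

theorem mainTheorem3 (s T : ℕ) (hs : 2 ≤ s) (hT : T < 2 ^ (2 ^ s - 1)) :
    -- the last `2 ^ (s - 1 - τ)` instances of every hanoi value are retained
    (∀ h : ℕ, Tilted.lastInstances (2 ^ (s - 1 - Tilted.metaEpoch (Tilted.epoch s T))) h T ⊆
      Tilted.retained s T) ∧
    -- keeping the last `n` instances of every hanoi value bounds the ratio by `1 / (n - 1 / 2)`
    (∀ (n : ℕ) (B : Set ℕ), 1 ≤ n → (∀ h : ℕ, Tilted.lastInstances n h T ⊆ B) →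
      Tilted.cost B T ≤ 1 / ((n : ℝ) - 1 / 2)) ∧
    -- the bound in epoch `0`, where `S / (4 t)` is infinite
    (Tilted.epoch s T = 0 → Tilted.cost (Tilted.retained s T) T = 0) ∧
    -- the bound in epochs `t ≥ 1`
    (1 ≤ Tilted.epoch s T →
      Tilted.cost (Tilted.retained s T) T ≤
        1 / (max (max ((2 : ℝ) ^ s / (2 * ((Tilted.epoch s T : ℝ) + s)))
                      ((2 : ℝ) ^ s / (4 * (Tilted.epoch s T : ℝ))))
                 ((2 : ℝ) ^ s / 2 ^ (Tilted.metaEpoch (Tilted.epoch s T) + 1)) - 1 / 2)) ∧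
    -- the overall bound
    Tilted.cost (Tilted.retained s T) T ≤ 2 := by
  have hms := Tilted.metaEpoch_epoch_lt (by omega) hT
  have hsub := Tilted.lastInstances_subset_retained hms
  refine ⟨hsub, fun n B hn hB => Tilted.cost_le_of_lastInstances_subset hn hB,
    fun h => Tilted.cost_eq_zero_of_discarded_eq_empty
      (Tilted.discarded_retained_eq_empty (by omega) h), fun ht => ?_, ?_⟩
  · rw [Tilted.max_instances_eq ht hms]
    exact Tilted.cost_le_of_lastInstances_subset Nat.one_le_two_pow hsub
  -- Since `τ < s`, at least one instance of each value is kept, and `n = 1` gives `1 / (1 - 1/2) =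
  -- 2`.
  · have h1 : 1 ≤ 2 ^ (s - 1 - Tilted.metaEpoch (Tilted.epoch s T)) := Nat.one_le_two_pow
    refine (Tilted.cost_le_of_lastInstances_subset le_rfl fun h u hu => hsub h ?_).trans
      (by norm_num)
    obtain ⟨h2, h3, h4⟩ := Tilted.mem_lastInstances_iff.1 hu
    exact Tilted.mem_lastInstances_iff.2 ⟨h2, h3, h4.trans (by gcongr)⟩
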